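/- Let $d\ge 1$, let $T\subset\mathbb{R}^d$ be a (closed, nondegenerate) $d$-dimensional simplex, and let $F$ be one of its $(d-1)$-dimensional faces. For an integer $m\ge 0$ let $\mathbb{P}_m(T)$ be the space of real polynomials on $T$ of total degree at most $m$, and let $\Pi_T^m$ be the $L^2(T)$-orthogonal projection onto $\mathbb{P}_m(T)$; put $\Pi_T^{-1}\xi:=0$. Let $p\ge 0$ and $n$ be integers with $-1\le n\le p$. Then for every $\xi\in\mathbb{P}_p(T)$ the polynomial $\theta:=\xi-\Pi_T^n\xi$ satisfies $$\|\theta\|_{L^2(F)}^2\;\le\;\frac{(p-n)(p+n+1+d)}{d}\,\frac{|F|}{|T|}\,\|\theta\|_{L^2(T)}^2 .$$ Here $|T|$ and $\|\cdot\|_{L^2(T)}$ refer to Lebesgue measure on $\mathbb{R}^d$, and $|F|$ and $\|\cdot\|_{L^2(F)}$ to the $(d-1)$-dimensional surface measure (the counting measure if $d=1$, so that then $|F|=1$). -/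

import Mathlib

open MeasureTheory

namespace InverseTrace

/-- The space `ℙ_n` of real polynomials in `d` variables of total degree at most `n`. A polynomial
is identified with the function it defines on a `d`-simplex of `ℝ^d`; this loses nothing, since such
a simplex has nonempty interior. -/
noncomputable abbrev Poly (d n : ℕ) : Submodule ℝ (MvPolynomial (Fin d) ℝ) :=
  MvPolynomial.restrictTotalDegree (Fin d) ℝ n

/-- The value of a polynomial at a point of `ℝ^d`. -/
noncomputable def val {d : ℕ} (q : MvPolynomial (Fin d) ℝ) (x : EuclideanSpace ℝ (Fin d)) : ℝ :=
  MvPolynomial.eval (fun i => x i) q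

/-- The squared norm `‖q‖²` in `L²(S, μ)`. -/
noncomputable def normSq {d : ℕ} (μ : Measure (EuclideanSpace ℝ (Fin d)))
    (S : Set (EuclideanSpace ℝ (Fin d))) (q : MvPolynomial (Fin d) ℝ) : ℝ :=
  ∫ x in S, (val q x) ^ 2 ∂μ

/-- `π` is the `L²(T)`-orthogonal projection of `ξ` onto `ℙ_n`: it lies in `ℙ_n`, and `ξ - π` is
orthogonal to `ℙ_n` in `L²(T)`. -/
def IsL2Proj {d : ℕ} (T : Affine.Simplex ℝ (EuclideanSpace ℝ (Fin d)) d) (n : ℕ)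
    (ξ π : MvPolynomial (Fin d) ℝ) : Prop :=
  π ∈ Poly d n ∧ ∀ q ∈ Poly d n, ∫ x in T.closedInterior, val (ξ - π) x * val q x = 0

theorem continuous_val {d : ℕ} (q : MvPolynomial (Fin d) ℝ) : Continuous (val q) := by
  unfold val
  exact (MvPolynomial.continuous_eval q).comp (by fun_prop)

theorem isCompact_simplex {d : ℕ} (T : Affine.Simplex ℝ (EuclideanSpace ℝ (Fin d)) d) :
    IsCompact T.closedInterior := by
  rw [← Affine.Simplex.convexHull_eq_closedInterior]
  exact (Set.finite_range T.points).isCompact_convexHull (𝕜 := ℝ)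

theorem integrableOn_val_mul {d : ℕ} (T : Affine.Simplex ℝ (EuclideanSpace ℝ (Fin d)) d)
    (q r : MvPolynomial (Fin d) ℝ) :
    IntegrableOn (fun x => val q x * val r x) T.closedInterior :=
  ((continuous_val q).mul (continuous_val r)).continuousOn.integrableOn_compact
    (isCompact_simplex T)

theorem interior_nonempty {d : ℕ} (T : Affine.Simplex ℝ (EuclideanSpace ℝ (Fin d)) d) :
    (interior T.closedInterior).Nonempty := by
  rw [← Affine.Simplex.convexHull_eq_closedInterior,
    interior_convexHull_nonempty_iff_affineSpan_eq_top]
  exact T.independent.affineSpan_eq_top_iff_card_eq_finrank_add_one.2 (by simp)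

/-- The `L²(T)` form is positive definite on polynomials. -/
theorem eq_zero_of_integral_sq {d : ℕ} (T : Affine.Simplex ℝ (EuclideanSpace ℝ (Fin d)) d)
    (q : MvPolynomial (Fin d) ℝ) (h : ∫ x in T.closedInterior, val q x * val q x = 0) :
    q = 0 := by
  rw [setIntegral_eq_zero_iff_of_nonneg_ae (Filter.Eventually.of_forall fun x => mul_self_nonneg _)
    (integrableOn_val_mul T q q)] at h
  have h1 : val q =ᵐ[volume.restrict (interior T.closedInterior)] fun _ => (0 : ℝ) := by
    have := ae_restrict_of_ae_restrict_of_subset interior_subset h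
    filter_upwards [this] with x hx using by simpa using hx
  have h2 := Measure.eqOn_open_of_ae_eq h1 isOpen_interior
    (continuous_val q).continuousOn continuousOn_const
  obtain ⟨x₀, hx₀⟩ := interior_nonempty T
  have han : AnalyticOnNhd ℝ (fun y : Fin d → ℝ => MvPolynomial.eval y q) Set.univ :=
    AnalyticOnNhd.eval_mvPolynomial q
  have hev : (fun y : Fin d → ℝ => MvPolynomial.eval y q) =ᶠ[nhds (fun i => x₀ i)] 0 := by
    have hc : Continuous (fun y : Fin d → ℝ => (WithLp.toLp 2 y : EuclideanSpace ℝ (Fin d))) := by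
      fun_prop
    have := hc.continuousAt.preimage_mem_nhds (x := fun i => x₀ i)
      (isOpen_interior.mem_nhds hx₀)
    filter_upwards [this] with y hy using h2 hy
  have hz := han.eq_of_eventuallyEq (fun _ _ => analyticAt_const) hev
  apply MvPolynomial.funext
  intro y
  rw [map_zero]
  exact congrFun hz y

/-- The `L²(T)` inner product as a bilinear form on polynomials. -/
noncomputable def l2Form {d : ℕ} (T : Affine.Simplex ℝ (EuclideanSpace ℝ (Fin d)) d) :
    MvPolynomial (Fin d) ℝ →ₗ[ℝ] MvPolynomial (Fin d) ℝ →ₗ[ℝ] ℝ :=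
  LinearMap.mk₂ ℝ (fun q r => ∫ x in T.closedInterior, val q x * val r x)
    (fun q₁ q₂ r => by
      rw [← integral_add (integrableOn_val_mul T q₁ r) (integrableOn_val_mul T q₂ r)]
      simp [val, add_mul])
    (fun c q r => by
      simp only [smul_eq_mul]
      rw [← integral_const_mul]
      simp [val, mul_assoc])
    (fun q r₁ r₂ => by
      rw [← integral_add (integrableOn_val_mul T q r₁) (integrableOn_val_mul T q r₂)]
      simp [val, mul_add])
    (fun c q r => by
      simp only [smul_eq_mul]
      rw [← integral_const_mul]
      simp [val, mul_left_comm])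

theorem existsUnique_isL2Proj {d : ℕ} (T : Affine.Simplex ℝ (EuclideanSpace ℝ (Fin d)) d) (n : ℕ)
    (ξ : MvPolynomial (Fin d) ℝ) : ∃! π, IsL2Proj T n ξ π := by
  let A : Poly d n →ₗ[ℝ] Module.Dual ℝ (Poly d n) :=
    (l2Form T).domRestrict₁₂ (Poly d n) (Poly d n)
  have hA : Function.Injective A := by
    rw [injective_iff_map_eq_zero]
    intro q hq
    have := LinearMap.congr_fun hq q
    exact Subtype.ext (eq_zero_of_integral_sq T q this)
  have hS : Function.Surjective A :=
    (LinearMap.injective_iff_surjective_of_finrank_eq_finrank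
      Subspace.dual_finrank_eq.symm).1 hA
  obtain ⟨π, hπ⟩ := hS ((l2Form T ξ).domRestrict (Poly d n))
  refine ⟨π, ⟨π.2, fun q hq => ?_⟩, fun π' h' => ?_⟩
  · have h := LinearMap.congr_fun hπ ⟨q, hq⟩
    have h : l2Form T π q = l2Form T ξ q := h
    change l2Form T (ξ - π) q = 0
    simp [h]
  · have h1 : A ⟨π', h'.1⟩ = A π := by
      rw [hπ]
      ext q
      have h2 : l2Form T (ξ - π') q = 0 := h'.2 q q.2
      change l2Form T π' q = l2Form T ξ q
      rw [map_sub, LinearMap.sub_apply, sub_eq_zero] at h2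
      exact h2.symm
    exact congrArg Subtype.val (hA h1)

/-- The `L²(T)`-orthogonal projection of the polynomial `ξ` onto `ℙ_n`, `n ≥ 0`. -/
noncomputable def l2Proj {d : ℕ} (T : Affine.Simplex ℝ (EuclideanSpace ℝ (Fin d)) d) (n : ℕ)
    (ξ : MvPolynomial (Fin d) ℝ) : MvPolynomial (Fin d) ℝ :=
  (existsUnique_isL2Proj T n ξ).choose

theorem isL2Proj_l2Proj {d : ℕ} (T : Affine.Simplex ℝ (EuclideanSpace ℝ (Fin d)) d) (n : ℕ)
    (ξ : MvPolynomial (Fin d) ℝ) : IsL2Proj T n ξ (l2Proj T n ξ) :=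
  (existsUnique_isL2Proj T n ξ).choose_spec.1

/-- `Π_T^n` for an integer index: the `L²(T)`-orthogonal projection onto `ℙ_n` if `n ≥ 0`, and `0`
if `n` is negative (only `n = -1` is used). -/
noncomputable def projT {d : ℕ} (T : Affine.Simplex ℝ (EuclideanSpace ℝ (Fin d)) d) :
    ℤ → MvPolynomial (Fin d) ℝ → MvPolynomial (Fin d) ℝ
  | Int.ofNat n, ξ => l2Proj T n ξ
  | Int.negSucc _, _ => 0

end InverseTrace

/-!
Let `v` be the vertex opposite to `F`, let `h` be the height over `F`, and put `D q = (x - v) · ∇q`.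
On the facets through `v` the field `x - v` is tangential, and on `F` its normal component is `h`,
so the divergence theorem gives `h ‖q‖²_F = d ‖q‖²_T + 2 ⟨D q, q⟩_T`. For `q` of degree `m` one has
`D q = m q` up to terms of lower degree; hence if `q` is moreover orthogonal to all polynomials of
lower degree, then `h ‖q‖²_F = (d + 2 m) ‖q‖²_T`. Splitting `θ` into its orthogonal components of
degrees `n + 1, …, p`, and applying the Cauchy-Schwarz inequality on `F`, one gets
`h ‖θ‖²_F ≤ ∑ (d + 2 m) ‖θ‖²_T`; the sum over these `m` is `(p - n) (p + n + 1 + d)`, and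
`h = d |T| / |F|`.
-/

namespace InverseTrace

section Filtration

section Field

variable {𝕜 V : Type*} [Field 𝕜] [AddCommGroup V] [Module 𝕜 V] {A : LinearMap.BilinForm 𝕜 V}

theorem isCompl_orthogonal_of_anisotropic (W : Submodule 𝕜 V) [FiniteDimensional 𝕜 W]
    (hA : ∀ x ∈ W, A x x = 0 → x = 0) : IsCompl W (A.orthogonal W) := by
  refine ⟨Submodule.disjoint_def.2 fun x hx hx' => hA x hx (hx' x hx), ?_⟩
  let Φ : W →ₗ[𝕜] Module.Dual 𝕜 W := A.flip.domRestrict₁₂ W W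
  have hinj : Function.Injective Φ := (injective_iff_map_eq_zero Φ).2 fun w hw =>
    Subtype.ext (hA w w.2 (LinearMap.congr_fun hw w))
  have hsurj : Function.Surjective Φ :=
    (LinearMap.injective_iff_surjective_of_finrank_eq_finrank Subspace.dual_finrank_eq.symm).1 hinj
  refine Submodule.codisjoint_iff_exists_add_eq.2 fun x => ?_
  obtain ⟨w, hw⟩ := hsurj ((A.flip x).domRestrict W)
  refine ⟨w, x - w, w.2, fun y hy => ?_, add_sub_cancel _ _⟩
  have hyw : A y w = A y x := LinearMap.congr_fun hw ⟨y, hy⟩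
  change A y (x - w) = 0
  rw [map_sub, hyw, sub_self]

end Field

section CommRing

variable {R V : Type*} [CommRing R] [AddCommGroup V] [Module R V] {A : LinearMap.BilinForm R V}

/-- The form `c ⟨x, y⟩ + ⟨D x, y⟩ + ⟨x, D y⟩` attached to a bilinear form `A = ⟨·, ·⟩`. For the
`L²` form of a cone with apex `v` in dimension `c`, and `D q = (x - v) · ∇q`, it is a multiple of
the `L²` form of the base of the cone. -/
def boundaryForm (A : LinearMap.BilinForm R V) (D : Module.End R V) (c : R) :
    LinearMap.BilinForm R V :=
  c • A + A.compLeft D + A.compRight D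

variable {D : Module.End R V} {c : R}

theorem boundaryForm_apply (x y : V) :
    boundaryForm A D c x y = c * A x y + A (D x) y + A x (D y) := rfl

theorem boundaryForm_isSymm (hA : A.IsSymm) : (boundaryForm A D c).IsSymm :=
  ⟨fun x y => by
    simp only [boundaryForm_apply, hA.eq x y, hA.eq (D x) y, hA.eq x (D y)]
    ring⟩

theorem boundaryForm_apply_self (hA : A.IsSymm) (x : V) :
    boundaryForm A D c x x = c * A x x + 2 * A (D x) x := by
  rw [boundaryForm_apply, hA.eq x (D x)]
  ring

theorem boundaryForm_apply_self_of_mem_orthogonal (hA : A.IsSymm)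
    {W : Submodule R V} {μ : R} {x : V} (hx : x ∈ A.orthogonal W) (hDx : D x - μ • x ∈ W) :
    boundaryForm A D c x x = (c + 2 * μ) * A x x := by
  have hD : A (D x) x = μ * A x x := by
    simpa [sub_eq_zero] using hx _ hDx
  rw [boundaryForm_apply_self hA, hD]
  ring

end CommRing

section OrderedField

variable {𝕜 V : Type*} [Field 𝕜] [LinearOrder 𝕜] [IsStrictOrderedRing 𝕜] [AddCommGroup V]
  [Module 𝕜 V] {A B : LinearMap.BilinForm 𝕜 V}

theorem apply_add_add_le_of_apply_eq_zero (hA : A.IsPosSemidef) (hB : B.IsPosSemidef) {a b : 𝕜}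
    (ha : 0 ≤ a) (hb : 0 ≤ b) {x y : V} (hxy : A x y = 0) (hx : B x x ≤ a * A x x)
    (hy : B y y ≤ b * A y y) : B (x + y) (x + y) ≤ (a + b) * A (x + y) (x + y) := by
  have hcauchy : B x y ^ 2 ≤ (b * A x x) * (a * A y y) :=
    calc B x y ^ 2 ≤ B x x * B y y :=
        B.apply_sq_le_of_symm hB.nonneg (LinearMap.BilinForm.isSymm_iff.1 hB.isSymm) x y
      _ ≤ (a * A x x) * (b * A y y) :=
        mul_le_mul hx hy (hB.nonneg y) (mul_nonneg ha (hA.nonneg x))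
      _ = _ := by ring
  have hcross : 2 * B x y ≤ b * A x x + a * A y y :=
    two_mul_le_add_of_sq_le_mul (mul_nonneg hb (hA.nonneg x)) (mul_nonneg ha (hA.nonneg y)) hcauchy
  have hyx : A y x = 0 := by rw [hA.isSymm.eq_iff]; exact hxy
  simp only [map_add, LinearMap.add_apply, hxy, hyx, hB.isSymm.eq y x]
  linarith

theorem boundaryForm_apply_self_le_sum {D : Module.End 𝕜 V} {c : 𝕜} {P : ℕ → Submodule 𝕜 V}
    (hA : A.IsSymm) (hpos : ∀ x, x ≠ 0 → 0 < A x x) (hc : 0 ≤ c)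
    (hB : (boundaryForm A D c).IsNonneg) (hP : Monotone P)
    [∀ m, FiniteDimensional 𝕜 (P m)]
    (hD : ∀ m, ∀ x ∈ P (m + 1), D x - (m : 𝕜) • x ∈ P m) {N M : ℕ} (hNM : N ≤ M) {x : V}
    (hx : x ∈ P M) (hxN : x ∈ A.orthogonal (P N)) :
    boundaryForm A D c x x ≤ (∑ m ∈ Finset.Ico N M, (c + 2 * m)) * A x x := by
  have hanis {m : ℕ} (x : V) (_ : x ∈ P m) (h : A x x = 0) : x = 0 :=
    by_contra fun hx => (hpos x hx).ne' h
  have hApos : A.IsPosSemidef :=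
    ⟨hA, ⟨fun x => by
      rcases eq_or_ne x 0 with rfl | hx
      · simp
      · exact (hpos x hx).le⟩⟩
  have hBpos : (boundaryForm A D c).IsPosSemidef := ⟨boundaryForm_isSymm hA, hB⟩
  have hterm (m : ℕ) : 0 ≤ c + 2 * (m : 𝕜) := by positivity
  induction M, hNM using Nat.le_induction generalizing x with
  | base =>
    have hx0 : x = 0 := (isCompl_orthogonal_of_anisotropic (P N) hanis).disjoint.le_bot ⟨hx, hxN⟩
    simp [hx0]
  | succ M hNM ih =>
    obtain ⟨y, z, hy, hz, rfl⟩ : ∃ y z, y ∈ P M ∧ z ∈ A.orthogonal (P M) ∧ y + z = x :=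
      Submodule.codisjoint_iff_exists_add_eq.1
        (isCompl_orthogonal_of_anisotropic (P M) hanis).codisjoint x
    have hzN : z ∈ A.orthogonal (P N) := LinearMap.BilinForm.orthogonal_le (hP hNM) hz
    have hyN : y ∈ A.orthogonal (P N) := by simpa using Submodule.sub_mem _ hxN hzN
    have hzM : z ∈ P (M + 1) := by simpa using Submodule.sub_mem _ hx (hP M.le_succ hy)
    rw [Finset.sum_Ico_succ_top hNM]
    exact apply_add_add_le_of_apply_eq_zero hApos hBpos (Finset.sum_nonneg fun m _ => hterm m)
      (hterm M) (hz y hy) (ih hy hyN)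
      (boundaryForm_apply_self_of_mem_orthogonal hA hz (hD M z hzM)).le

end OrderedField

theorem sum_Ico_add_two_mul {R : Type*} [CommRing R] (c : R) {N M : ℕ} (hNM : N ≤ M) :
    ∑ m ∈ Finset.Ico N M, (c + 2 * m) = (M - N) * (M + N - 1 + c) := by
  induction M, hNM using Nat.le_induction with
  | base => simp
  | succ M hNM ih =>
    rw [Finset.sum_Ico_succ_top hNM, ih]
    push_cast
    ring

end Filtration

section Euler

open MvPolynomial

variable {σ R : Type*} [CommRing R]

/-- The Euler derivation `q ↦ (x - v) · ∇q` centred at `v`, given by its values `X i - v i` on the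
variables. Modulo polynomials of lower degree it multiplies a polynomial by its degree. -/
noncomputable def radialDerivation (v : σ → R) :
    Derivation R (MvPolynomial σ R) (MvPolynomial σ R) :=
  mkDerivation R fun i => X i - C (v i)

variable (σ R) in
/-- Polynomials of total degree less than `n`. The strict bound makes `ℙ_{-1} = 0` the case `n = 0`
of the filtration. -/
noncomputable def totalDegreeLT (n : ℕ) : Submodule R (MvPolynomial σ R) :=
  restrictSupport R {s | s.degree < n}

theorem totalDegreeLT_zero : totalDegreeLT σ R 0 = ⊥ := by
  simp [totalDegreeLT, restrictSupport_eq_span]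

theorem totalDegreeLT_succ (n : ℕ) : totalDegreeLT σ R (n + 1) = restrictTotalDegree σ R n := by
  simp only [totalDegreeLT, Nat.lt_succ_iff]
  rfl

theorem totalDegreeLT_mono : Monotone (totalDegreeLT σ R) := fun _ _ h =>
  restrictSupport_mono R fun _ hs => lt_of_lt_of_le hs h

instance finiteDimensional_totalDegreeLT {σ K : Type*} [Finite σ] [Field K] (m : ℕ) :
    FiniteDimensional K (totalDegreeLT σ K m) :=
  Submodule.finiteDimensional_of_le
    ((totalDegreeLT_mono m.le_succ).trans (totalDegreeLT_succ (R := K) m).le)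

theorem radialDerivation_monomial_sub_smul_mem (v : σ → R) (s : σ →₀ ℕ) :
    radialDerivation v (monomial s 1) - (s.degree : R) • monomial s 1 ∈
      totalDegreeLT σ R s.degree := by
  have hdegree : (s.degree : R) • monomial s (1 : R) =
      ∑ i ∈ s.support, monomial (s - Finsupp.single i 1) (s i : R) * X i := by
    have hterm (i : σ) : monomial (s - Finsupp.single i 1) (s i : R) * X i =
        (s i : R) • monomial s 1 := by
      rw [← one_mul (s i : R), ← pderiv_monomial, mul_comm, X_mul_pderiv_monomial,
        one_mul, Nat.cast_smul_eq_nsmul]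
    rw [Finset.sum_congr rfl fun i _ => hterm i, ← Finset.sum_smul, Finsupp.degree_apply,
      Nat.cast_sum]
  rw [radialDerivation, mkDerivation_monomial, one_smul, hdegree, Finsupp.sum,
    ← Finset.sum_sub_distrib]
  refine Submodule.sum_mem _ fun i hi => ?_
  rw [smul_eq_mul, mul_sub, sub_sub_cancel_left, mul_comm, ← smul_eq_C_mul]
  refine Submodule.neg_mem _ (Submodule.smul_mem _ _
    ((monomial_mem_restrictSupport R).2 (Or.inl ?_)))
  have hle : Finsupp.single i 1 ≤ s :=
    Finsupp.single_le_iff.2 (Nat.one_le_iff_ne_zero.2 (Finsupp.mem_support_iff.1 hi))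
  have hdeg := congrArg Finsupp.degree (tsub_add_cancel_of_le hle)
  rw [map_add, Finsupp.degree_single] at hdeg
  exact Nat.lt_of_succ_le hdeg.le

theorem radialDerivation_sub_smul_mem (v : σ → R) {m : ℕ} {q : MvPolynomial σ R}
    (hq : q ∈ totalDegreeLT σ R (m + 1)) :
    radialDerivation v q - (m : R) • q ∈ totalDegreeLT σ R m := by
  rw [totalDegreeLT, restrictSupport_eq_span] at hq
  induction hq using Submodule.span_induction with
  | zero => simp
  | add p q _ _ hp hq =>
    rw [map_add, smul_add, add_sub_add_comm]
    exact Submodule.add_mem _ hp hq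
  | smul c p _ hp =>
    rw [Derivation.map_smul, smul_comm, ← smul_sub]
    exact Submodule.smul_mem _ _ hp
  | mem q h =>
    obtain ⟨s, hs, rfl⟩ := h
    have hEuler := radialDerivation_monomial_sub_smul_mem (R := R) v s
    rcases Nat.lt_succ_iff_lt_or_eq.1 hs with hlt | rfl
    · have hmem : monomial s (1 : R) ∈ totalDegreeLT σ R m :=
        (monomial_mem_restrictSupport R).2 (Or.inl hlt)
      have hrad : radialDerivation v (monomial s (1 : R)) ∈ totalDegreeLT σ R m := by
        simpa using Submodule.add_mem _ (totalDegreeLT_mono hlt.le hEuler)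
          (Submodule.smul_mem _ (s.degree : R) hmem)
      exact Submodule.sub_mem _ hrad (Submodule.smul_mem _ _ hmem)
    · exact hEuler

end Euler

section Cone

open scoped InnerProductSpace

theorem isCompact_convexJoin {V : Type*} [AddCommGroup V] [Module ℝ V] [TopologicalSpace V]
    [ContinuousAdd V] [ContinuousSMul ℝ V] {s t : Set V} (hs : IsCompact s) (ht : IsCompact t) :
    IsCompact (convexJoin ℝ s t) := by
  have himage : convexJoin ℝ s t =
      (fun q : ℝ × V × V => (1 - q.1) • q.2.1 + q.1 • q.2.2) '' Set.Icc 0 1 ×ˢ s ×ˢ t := by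
    ext x
    simp only [mem_convexJoin, segment_eq_image, Set.mem_image, Set.mem_prod, Prod.exists]
    grind
  rw [himage]
  exact (isCompact_Icc.prod (hs.prod ht)).image (by fun_prop)

theorem integral_pow_mul_ray {V : Type*} [NormedAddCommGroup V] [NormedSpace ℝ V] {f : V → ℝ}
    (hf : ContDiff ℝ 1 f) (v u : V) (k : ℕ) :
    ∫ t in (0 : ℝ)..1, t ^ k * ((k + 1) * f (v + t • u) + fderiv ℝ f (v + t • u) (t • u)) =
      f (v + u) := by
  have hray (t : ℝ) : HasDerivAt (fun s : ℝ => v + s • u) u t := by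
    simpa using ((hasDerivAt_id t).smul_const u).const_add v
  have hderiv (t : ℝ) : HasDerivAt (fun s : ℝ => s ^ (k + 1) * f (v + s • u))
      (t ^ k * ((k + 1) * f (v + t • u) + fderiv ℝ f (v + t • u) (t • u))) t := by
    convert! (hasDerivAt_pow (k + 1) t).mul
      ((hf.differentiable one_ne_zero _).hasFDerivAt.comp_hasDerivAt t (hray t)) using 1
    simp only [map_smul, smul_eq_mul, Function.comp_apply]
    push_cast
    ring
  have hcont : Continuous fun t : ℝ =>
      t ^ k * ((k + 1) * f (v + t • u) + fderiv ℝ f (v + t • u) (t • u)) := by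
    have := hf.continuous
    have := hf.continuous_fderiv one_ne_zero
    fun_prop
  rw [intervalIntegral.integral_eq_sub_of_hasDerivAt (fun t _ => hderiv t)
    (hcont.intervalIntegrable _ _)]
  simp

variable {E : Type*} [NormedAddCommGroup E] [InnerProductSpace ℝ E] {v ν : E} {F : Set E}

theorem add_smul_mem_convexJoin_singleton_iff (hν : ν ≠ 0)
    (hF : F ⊆ AffineSubspace.mk' (v + ν) (ℝ ∙ ν)ᗮ) {t : ℝ} (ht : t ≠ 0) (w : (ℝ ∙ ν)ᗮ) :
    v + t • (ν + w) ∈ convexJoin ℝ {v} F ↔ t ∈ Set.Icc (0 : ℝ) 1 ∧ v + ν + w ∈ F := by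
  simp only [convexJoin_singleton_left, Set.mem_iUnion₂, segment_eq_image_lineMap, Set.mem_image,
    AffineMap.lineMap_apply, vsub_eq_sub, vadd_eq_add, add_comm _ v, add_right_inj, exists_prop]
  constructor
  · rintro ⟨y, hy, s, hs, hst⟩
    have horth : ⟪ν, y - (v + ν)⟫_ℝ = 0 :=
      Submodule.mem_orthogonal_singleton_iff_inner_right.1 (hF hy)
    have hinner : ⟪ν, y - v⟫_ℝ = ⟪ν, ν⟫_ℝ := by
      rwa [← sub_sub, inner_sub_right, sub_eq_zero] at horth
    have hw : ⟪ν, (w : E)⟫_ℝ = 0 := Submodule.mem_orthogonal_singleton_iff_inner_right.1 w.2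
    have hts : s = t := by
      have h := congrArg (fun x => ⟪ν, x⟫_ℝ) hst
      simp only [inner_smul_right, inner_add_right, hinner, hw, add_zero] at h
      exact mul_right_cancel₀ (inner_self_ne_zero.2 hν) h
    subst hts
    rw [add_assoc, ← smul_right_injective E ht hst, add_sub_cancel]
    exact ⟨hs, hy⟩
  · rintro ⟨ht, hw⟩
    exact ⟨_, hw, t, ht, by rw [add_assoc, add_sub_cancel_left]⟩

variable [FiniteDimensional ℝ E]

theorem finrank_orthogonal_span_singleton_of_ne_zero (hν : ν ≠ 0) :
    Module.finrank ℝ (ℝ ∙ ν)ᗮ = Module.finrank ℝ E - 1 := by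
  have h := (ℝ ∙ ν).finrank_add_finrank_orthogonal
  rw [finrank_span_singleton hν] at h
  omega

variable [MeasurableSpace E] [BorelSpace E]

theorem integral_eq_norm_mul_integral_integral (hν : ν ≠ 0) (v : E) {G : E → ℝ}
    (hG : Integrable G) : ∫ x, G x = ‖ν‖ * ∫ t : ℝ, ∫ w : (ℝ ∙ ν)ᗮ, G (v + t • ν + w) := by
  set W := (ℝ ∙ ν)ᗮ
  have hmp : MeasurePreserving (W.measurableEquivProd v) volume volume := by
    have h := W.measurePreserving_measurableEquivProd v
    rwa [InnerProductSpace.euclideanHausdorffMeasure_eq_volume] at h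
  have hW : Module.finrank ℝ Wᗮ = 1 := by
    rw [Submodule.orthogonal_orthogonal, finrank_span_singleton hν]
  let n : Wᗮ := ⟨ν, Submodule.le_orthogonal_orthogonal _ (Submodule.mem_span_singleton_self ν)⟩
  have hn : n ≠ 0 := fun h => hν (congrArg Subtype.val h)
  have hemb : MeasurableEmbedding (fun t : ℝ => t • n) :=
    (isClosedEmbedding_smul_left hn).measurableEmbedding
  have hG' : Integrable (fun q => G ((W.measurableEquivProd v).symm q)) (volume.prod volume) :=
    hmp.symm.integrable_comp_of_integrable hG
  rw [← hmp.symm.integral_comp (MeasurableEquiv.measurableEmbedding _) G, Measure.volume_eq_prod,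
    integral_prod_symm _ hG', volume_eq_of_finrank_eq_one hW hn, integral_smul_measure,
    hemb.integral_map]
  simp only [toReal_enorm, smul_eq_mul, Submodule.measurableEquivProd_symm_apply, vadd_eq_add,
    Submodule.coe_smul]
  simp only [n, add_comm, add_left_comm, Submodule.coe_norm]

theorem integral_eq_norm_mul_integral_abs_pow_mul_integral (hν : ν ≠ 0) (v : E) {G : E → ℝ}
    (hG : Integrable G) :
    ∫ x, G x = ‖ν‖ * ∫ t : ℝ, |t| ^ (Module.finrank ℝ E - 1) *
      ∫ w : (ℝ ∙ ν)ᗮ, G (v + t • (ν + w)) := by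
  rw [integral_eq_norm_mul_integral_integral hν v hG]
  congr 1
  refine integral_congr_ae ((Measure.ae_ne volume 0).mono fun t ht => ?_)
  have h := Measure.integral_comp_smul (volume : Measure (ℝ ∙ ν)ᗮ)
    (fun w => G (v + t • ν + w)) t
  rw [finrank_orthogonal_span_singleton_of_ne_zero hν, abs_inv, abs_pow, smul_eq_mul,
    eq_inv_mul_iff_mul_eq₀ (by positivity)] at h
  simpa only [smul_add, Submodule.coe_smul, add_assoc] using h.symm

theorem abs_pow_mul_integral_indicator_convexJoin_singleton (hν : ν ≠ 0) (hFm : MeasurableSet F)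
    (hF : F ⊆ AffineSubspace.mk' (v + ν) (ℝ ∙ ν)ᗮ) (g : E → ℝ) (k : ℕ) {t : ℝ} (ht : t ≠ 0) :
    |t| ^ k * ∫ w : (ℝ ∙ ν)ᗮ, (convexJoin ℝ {v} F).indicator g (v + t • (ν + w)) =
      (Set.Ioc (0 : ℝ) 1).indicator (fun t => ∫ w in (fun w : (ℝ ∙ ν)ᗮ => v + ν + (w : E)) ⁻¹' F,
        t ^ k * g (v + t • (ν + w))) t := by
  have hmem (w : (ℝ ∙ ν)ᗮ) := add_smul_mem_convexJoin_singleton_iff hν hF ht w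
  by_cases ht1 : t ∈ Set.Ioc (0 : ℝ) 1
  · have hind (w : (ℝ ∙ ν)ᗮ) : (convexJoin ℝ {v} F).indicator g (v + t • (ν + w)) =
        ((fun w : (ℝ ∙ ν)ᗮ => v + ν + (w : E)) ⁻¹' F).indicator
          (fun w => g (v + t • (ν + w))) w := by
      classical
      simp only [Set.indicator_apply, hmem, Set.Ioc_subset_Icc_self ht1, true_and,
        Set.mem_preimage]
    rw [Set.indicator_of_mem ht1, integral_const_mul, abs_of_pos ht1.1,
      integral_congr_ae (.of_forall hind), integral_indicator (hFm.preimage (by fun_prop))]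
  · have hnot (w : (ℝ ∙ ν)ᗮ) : v + t • (ν + w) ∉ convexJoin ℝ {v} F := fun h =>
      ht1 ⟨lt_of_le_of_ne ((hmem w).1 h).1.1 ht.symm, ((hmem w).1 h).1.2⟩
    simp only [Set.indicator_of_notMem ht1, Set.indicator_of_notMem (hnot _), integral_zero,
      mul_zero]

theorem setIntegral_convexJoin_singleton (hν : ν ≠ 0) (hFc : IsCompact F)
    (hF : F ⊆ AffineSubspace.mk' (v + ν) (ℝ ∙ ν)ᗮ) {g : E → ℝ} (hg : Continuous g) :
    ∫ x in convexJoin ℝ {v} F, g x =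
      ‖ν‖ * ∫ w in (fun w : (ℝ ∙ ν)ᗮ => v + ν + (w : E)) ⁻¹' F,
        ∫ t in (0 : ℝ)..1, t ^ (Module.finrank ℝ E - 1) * g (v + t • (ν + w)) := by
  have hC : IsCompact (convexJoin ℝ {v} F) := isCompact_convexJoin isCompact_singleton hFc
  have hK : IsCompact ((fun w : (ℝ ∙ ν)ᗮ => v + ν + (w : E)) ⁻¹' F) :=
    ((IsometryEquiv.addLeft (v + ν)).isometry.isClosedEmbedding.comp
      (ℝ ∙ ν)ᗮ.closed_of_finiteDimensional.isClosedEmbedding_subtypeVal).isCompact_preimage hFc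
  have hcont : Continuous (Function.uncurry fun (t : ℝ) (w : (ℝ ∙ ν)ᗮ) =>
      t ^ (Module.finrank ℝ E - 1) * g (v + t • (ν + w))) := by
    unfold Function.uncurry
    fun_prop
  have hint : Integrable ((convexJoin ℝ {v} F).indicator g) :=
    (hg.continuousOn.integrableOn_compact hC).integrable_indicator hC.measurableSet
  rw [← integral_indicator hC.measurableSet,
    integral_eq_norm_mul_integral_abs_pow_mul_integral hν v hint,
    integral_congr_ae ((Measure.ae_ne volume 0).mono fun t ht =>
      abs_pow_mul_integral_indicator_convexJoin_singleton hν hFc.measurableSet hF g _ ht),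
    integral_indicator measurableSet_Ioc]
  simp only [intervalIntegral.integral_of_le zero_le_one]
  congr 1
  apply integral_integral_swap
  rw [Measure.prod_restrict]
  exact (hcont.continuousOn.integrableOn_compact (isCompact_Icc.prod hK)).mono_set
    (Set.prod_mono Set.Ioc_subset_Icc_self subset_rfl)

theorem setIntegral_euclideanHausdorffMeasure_of_subset_mk' {W : Submodule ℝ E} {p : E}
    (hF : F ⊆ AffineSubspace.mk' p W) (f : E → ℝ) :
    ∫ x in F, f x ∂μHE[Module.finrank ℝ W] =
      ∫ w in (fun w : W => p + (w : E)) ⁻¹' F, f (p + w) := by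
  have hiso : Isometry fun w : W => p + (w : E) :=
    (isometry_add_left p).comp isometry_subtype_coe
  have hsub : F ⊆ Set.range fun w : W => p + (w : E) := fun y hy =>
    ⟨⟨y - p, hF hy⟩, add_sub_cancel _ _⟩
  rw [← Measure.restrict_restrict_of_subset hsub, ← hiso.map_euclideanHausdorffMeasure,
    hiso.isClosedEmbedding.measurableEmbedding.setIntegral_map,
    InnerProductSpace.euclideanHausdorffMeasure_eq_volume]

theorem integral_convexJoin_singleton_divergence (hν : ν ≠ 0) (hFc : IsCompact F)
    (hF : F ⊆ AffineSubspace.mk' (v + ν) (ℝ ∙ ν)ᗮ) {f : E → ℝ} (hf : ContDiff ℝ 1 f) :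
    ∫ x in convexJoin ℝ {v} F, (Module.finrank ℝ E * f x + fderiv ℝ f x (x - v)) =
      ‖ν‖ * ∫ x in F, f x ∂μHE[Module.finrank ℝ E - 1] := by
  have hE : Module.finrank ℝ E = ((Module.finrank ℝ E - 1 : ℕ) : ℝ) + 1 := by
    have hpos : 0 < Module.finrank ℝ E := Module.finrank_pos_iff_exists_ne_zero.2 ⟨ν, hν⟩
    exact_mod_cast (Nat.sub_add_cancel hpos).symm
  have hcont : Continuous fun x => Module.finrank ℝ E * f x + fderiv ℝ f x (x - v) := by
    have := hf.continuous
    have := hf.continuous_fderiv one_ne_zero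
    fun_prop
  rw [setIntegral_convexJoin_singleton hν hFc hF hcont,
    ← finrank_orthogonal_span_singleton_of_ne_zero hν,
    setIntegral_euclideanHausdorffMeasure_of_subset_mk' hF,
    finrank_orthogonal_span_singleton_of_ne_zero hν]
  simp only [hE, add_sub_cancel_left, integral_pow_mul_ray hf, add_assoc]

end Cone

section Simplex

theorem closedInterior_eq_convexJoin_faceOpposite {𝕜 V : Type*} [Field 𝕜] [LinearOrder 𝕜]
    [IsStrictOrderedRing 𝕜] [AddCommGroup V] [Module 𝕜 V] {n : ℕ} [NeZero n]
    (T : Affine.Simplex 𝕜 V n) (i : Fin (n + 1)) :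
    T.closedInterior = convexJoin 𝕜 {T.points i} (T.faceOpposite i).closedInterior := by
  have hrange : Set.range T.points =
      insert (T.points i) (Set.range (T.faceOpposite i).points) := by
    rw [Affine.Simplex.range_faceOpposite_points, ← Set.image_insert_eq, ← Set.union_singleton,
      Set.compl_union_self, Set.image_univ]
  rw [← Affine.Simplex.convexHull_eq_closedInterior, hrange,
    convexHull_insert (Set.range_nonempty _), Affine.Simplex.convexHull_eq_closedInterior]

variable {E : Type*} [NormedAddCommGroup E] [InnerProductSpace ℝ E] {n : ℕ} [NeZero n]
  (T : Affine.Simplex ℝ E n) (i : Fin (n + 1))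

theorem closedInterior_faceOpposite_subset_mk' :
    (T.faceOpposite i).closedInterior ⊆
      AffineSubspace.mk' (T.altitudeFoot i) (ℝ ∙ (T.altitudeFoot i - T.points i))ᗮ := by
  refine (T.faceOpposite i).closedInterior_subset_affineSpan.trans (affineSpan_le.2 ?_)
  rw [Affine.Simplex.range_faceOpposite_points]
  rintro _ ⟨j, hj, rfl⟩
  rw [SetLike.mem_coe, AffineSubspace.mem_mk', Submodule.mem_orthogonal_singleton_iff_inner_left,
    ← neg_sub, inner_neg_right, neg_eq_zero]
  exact T.inner_vsub_altitudeFoot_vsub_altitudeFoot_eq_zero (Ne.symm hj)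

variable [FiniteDimensional ℝ E] [MeasurableSpace E] [BorelSpace E]

theorem integral_closedInterior_divergence {f : E → ℝ} (hf : ContDiff ℝ 1 f) :
    ∫ x in T.closedInterior, (Module.finrank ℝ E * f x + fderiv ℝ f x (x - T.points i)) =
      T.height i * ∫ x in (T.faceOpposite i).closedInterior, f x ∂μHE[Module.finrank ℝ E - 1] := by
  rw [closedInterior_eq_convexJoin_faceOpposite T i,
    integral_convexJoin_singleton_divergence (sub_ne_zero.2 (T.ne_altitudeFoot i).symm)
      (T.faceOpposite i).isCompact_closedInterior _ hf, ← dist_eq_norm, dist_comm]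
  · rfl
  · rw [add_sub_cancel]
    exact closedInterior_faceOpposite_subset_mk' T i

theorem finrank_mul_volume_closedInterior :
    Module.finrank ℝ E * volume.real T.closedInterior = T.height i *
      (μHE[Module.finrank ℝ E - 1]).real (T.faceOpposite i).closedInterior := by
  simpa [mul_comm] using integral_closedInterior_divergence T i (contDiff_const (c := (1 : ℝ)))

end Simplex

section Polynomial

variable {d : ℕ}

theorem val_add (q r : MvPolynomial (Fin d) ℝ) :
    (val (q + r) : EuclideanSpace ℝ (Fin d) → ℝ) = val q + val r :=
  funext fun _ => map_add _ q r

theorem val_mul (q r : MvPolynomial (Fin d) ℝ) (x : EuclideanSpace ℝ (Fin d)) :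
    val (q * r) x = val q x * val r x := map_mul _ q r

theorem contDiff_val (q : MvPolynomial (Fin d) ℝ) {k : WithTop ℕ∞} : ContDiff ℝ k (val q) := by
  have hcoord : ContDiff ℝ k fun (x : EuclideanSpace ℝ (Fin d)) i => x i := by fun_prop
  have heval : ContDiff ℝ k fun y : Fin d → ℝ => MvPolynomial.eval y q :=
    (AnalyticOnNhd.eval_mvPolynomial q).contDiff
  exact heval.comp hcoord

theorem fderiv_val_sub (v x : EuclideanSpace ℝ (Fin d)) (q : MvPolynomial (Fin d) ℝ) :
    fderiv ℝ (val q) x (x - v) = val (radialDerivation v q) x := by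
  have hdiff (q : MvPolynomial (Fin d) ℝ) : DifferentiableAt ℝ (val q) x :=
    (contDiff_val q).differentiable one_ne_zero x
  induction q using MvPolynomial.induction_on with
  | C a =>
    have hC : val (MvPolynomial.C a) = fun _ : EuclideanSpace ℝ (Fin d) => a := by
      ext
      simp [val]
    simp [hC, radialDerivation, val]
  | add p q hp hq =>
    rw [val_add, fderiv_add (hdiff p) (hdiff q), add_apply, hp, hq, map_add, val_add, Pi.add_apply]
  | mul_X p j hp =>
    have hmul : val (p * MvPolynomial.X j) =
        fun x => val p x * EuclideanSpace.proj (𝕜 := ℝ) j x := by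
      ext
      simp [val]
    rw [hmul, fderiv_fun_mul (hdiff p) (ContinuousLinearMap.differentiableAt _),
      ContinuousLinearMap.fderiv, add_apply, smul_apply, smul_apply, hp]
    simp [radialDerivation, val, MvPolynomial.mkDerivation_X]

variable (T : Affine.Simplex ℝ (EuclideanSpace ℝ (Fin d)) d)

theorem l2Form_apply (q r : MvPolynomial (Fin d) ℝ) :
    l2Form T q r = ∫ x in T.closedInterior, val (q * r) x := by
  simp only [val_mul]
  rfl

theorem l2Form_isSymm : LinearMap.BilinForm.IsSymm (l2Form T) :=
  ⟨fun q r => by rw [l2Form_apply, l2Form_apply, mul_comm]⟩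

theorem normSq_volume (q : MvPolynomial (Fin d) ℝ) :
    normSq volume T.closedInterior q = l2Form T q q := by
  simp only [normSq, l2Form_apply, val_mul, sq]

theorem l2Form_self_pos {q : MvPolynomial (Fin d) ℝ} (hq : q ≠ 0) : 0 < l2Form T q q :=
  lt_of_le_of_ne (integral_nonneg fun _ => mul_self_nonneg _)
    fun h => hq (eq_zero_of_integral_sq T q h.symm)

theorem volume_closedInterior_pos : 0 < volume.real T.closedInterior :=
  ENNReal.toReal_pos
    (Measure.measure_pos_of_nonempty_interior _ (interior_nonempty T)).ne'
    (isCompact_simplex T).measure_lt_top.ne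

section Facet

variable [NeZero d] (i : Fin (d + 1))

theorem boundaryForm_l2Form_apply_self (q : MvPolynomial (Fin d) ℝ) :
    boundaryForm (l2Form T) (radialDerivation (T.points i) : Module.End ℝ _) d q q =
      T.height i * normSq (μHE[d - 1]) (T.faceOpposite i).closedInterior q := by
  have hdiv := integral_closedInterior_divergence T i (contDiff_val (q * q))
  have hpointwise (x : EuclideanSpace ℝ (Fin d)) :
      val (((d : ℝ) • q + (2 : ℝ) • radialDerivation (T.points i) q) * q) x =
        d * val (q * q) x + val (radialDerivation (T.points i) (q * q)) x := by
    simp only [val, Derivation.leibniz, map_add, map_mul, MvPolynomial.smul_eval, smul_eq_mul]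
    ring
  calc boundaryForm (l2Form T) (radialDerivation (T.points i) : Module.End ℝ _) d q q
      = l2Form T ((d : ℝ) • q + (2 : ℝ) • radialDerivation (T.points i) q) q := by
        rw [boundaryForm_apply_self (l2Form_isSymm T)]
        simp
    _ = ∫ x in T.closedInterior,
          (d * val (q * q) x + val (radialDerivation (T.points i) (q * q)) x) := by
        simp only [l2Form_apply, hpointwise]
    _ = T.height i * normSq (μHE[d - 1]) (T.faceOpposite i).closedInterior q := by
        simpa only [finrank_euclideanSpace_fin, fderiv_val_sub, val_mul, normSq, sq] using hdiv

theorem normSq_facet_le {N M : ℕ} (hNM : N ≤ M) {q : MvPolynomial (Fin d) ℝ}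
    (hq : q ∈ totalDegreeLT (Fin d) ℝ M)
    (hqN : q ∈ LinearMap.BilinForm.orthogonal (l2Form T) (totalDegreeLT (Fin d) ℝ N)) :
    normSq (μHE[d - 1]) (T.faceOpposite i).closedInterior q ≤
      ((M : ℝ) - N) * (M + N - 1 + d) / d *
        ((μHE[d - 1]).real (T.faceOpposite i).closedInterior / volume.real T.closedInterior) *
        normSq volume T.closedInterior q := by
  have hform : T.height i * normSq (μHE[d - 1]) (T.faceOpposite i).closedInterior q ≤
      ((M : ℝ) - N) * (M + N - 1 + d) * normSq volume T.closedInterior q := by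
    rw [← boundaryForm_l2Form_apply_self, ← sum_Ico_add_two_mul _ hNM, normSq_volume]
    refine boundaryForm_apply_self_le_sum (l2Form_isSymm T) (fun q hq => l2Form_self_pos T hq)
      d.cast_nonneg ⟨fun q => ?_⟩ totalDegreeLT_mono
      (fun m q hq => radialDerivation_sub_smul_mem _ hq) hNM hq hqN
    rw [boundaryForm_l2Form_apply_self]
    exact mul_nonneg (T.height_pos i).le (integral_nonneg fun _ => sq_nonneg _)
  have hvol := finrank_mul_volume_closedInterior T i
  rw [finrank_euclideanSpace_fin] at hvol
  have hheight := T.height_pos i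
  have hpos := volume_closedInterior_pos T
  have hd : (d : ℝ) ≠ 0 := NeZero.ne _
  calc normSq (μHE[d - 1]) (T.faceOpposite i).closedInterior q
      ≤ ((M : ℝ) - N) * (M + N - 1 + d) * normSq volume T.closedInterior q / T.height i :=
        (le_div_iff₀' hheight).2 hform
    _ = _ := by
        field_simp
        linear_combination ((M : ℝ) - N) * (M + N - 1 + d) * normSq volume T.closedInterior q * hvol

end Facet

theorem sub_projT_mem {p : ℕ} {n : ℤ} (hnp : n ≤ p) {ξ : MvPolynomial (Fin d) ℝ}
    (hξ : ξ ∈ Poly d p) : ξ - projT T n ξ ∈ totalDegreeLT (Fin d) ℝ (p + 1) := by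
  refine Submodule.sub_mem _ ((totalDegreeLT_succ p).ge hξ) ?_
  match n with
  | Int.ofNat m =>
    have hm : m + 1 ≤ p + 1 := Nat.succ_le_succ (Int.ofNat_le.1 hnp)
    exact totalDegreeLT_mono hm ((totalDegreeLT_succ m).ge (isL2Proj_l2Proj T m ξ).1)
  | Int.negSucc _ => exact Submodule.zero_mem _

theorem sub_projT_mem_orthogonal (n : ℤ) (ξ : MvPolynomial (Fin d) ℝ) :
    ξ - projT T n ξ ∈
      LinearMap.BilinForm.orthogonal (l2Form T) (totalDegreeLT (Fin d) ℝ (n + 1).toNat) := by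
  intro q hq
  match n with
  | Int.ofNat m =>
    rw [(l2Form_isSymm T).eq]
    exact (isL2Proj_l2Proj T m ξ).2 q ((totalDegreeLT_succ m).le hq)
  | Int.negSucc m =>
    have hq : q ∈ totalDegreeLT (Fin d) ℝ 0 := by
      rwa [Int.toNat_of_nonpos (by omega)] at hq
    rw [totalDegreeLT_zero, Submodule.mem_bot] at hq
    simp [hq]

end Polynomial

end InverseTrace

theorem theorem1 {d : ℕ} [NeZero d]
    (T : Affine.Simplex ℝ (EuclideanSpace ℝ (Fin d)) d) (i : Fin (d + 1))
    (p : ℕ) (n : ℤ) (hn : -1 ≤ n) (hnp : n ≤ p)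
    (ξ : MvPolynomial (Fin d) ℝ) (hξ : ξ ∈ InverseTrace.Poly d p) :
    InverseTrace.normSq (μHE[d - 1])
        (T.faceOpposite i).closedInterior (ξ - InverseTrace.projT T n ξ) ≤
      ((p : ℝ) - n) * (p + n + 1 + d) / d *
        ((μHE[d - 1]).real (T.faceOpposite i).closedInterior /
          volume.real T.closedInterior) *
        InverseTrace.normSq volume T.closedInterior (ξ - InverseTrace.projT T n ξ) := by
  have hmem := InverseTrace.sub_projT_mem T hnp hξ
  have horth := InverseTrace.sub_projT_mem_orthogonal T n ξ
  have hcast : (((n + 1).toNat : ℕ) : ℝ) = n + 1 := by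
    exact_mod_cast Int.toNat_of_nonneg (by omega)
  convert! InverseTrace.normSq_facet_le T i (by omega) hmem horth using 4
  rw [hcast]
  push_cast
  ring
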